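/- Let $S$ be a commutative semigroup, written additively, with neutral element $0$. Let $E = E_{\mathbb R} \oplus i E_{\mathbb R}$ be a complex Banach lattice, i.e. the complexification of a real Banach lattice $E_{\mathbb R}$, with modulus $|z| = \sup\{\operatorname{Re}(cz) : c \in \mathbb{C},\ |c| = 1\} \in E_{\mathbb R}$ and norm $\|z\| = \|\,|z|\,\|_{E_{\mathbb R}}$. Let $\mathscr{L}(E)$ be the Banach algebra of bounded linear operators on $E$, and let $T \colon S \to \mathscr{L}(E)$ be a representation, i.e. $T_0 = 1$ and $T_{s+t} = T_s T_t$ for all $s, t \in S$. Suppose that - $T$ is bounded: $\sup_{s \in S} \|T_s\| < \infty$; - $T$ is positive: for every $s \in S$, $T_s$ maps $\{x \in E_{\mathbb R} : x \ge 0\}$ into itself; - $T$ is uniformly mean ergodic: the operator norm closed convex hull $\overline{\mathrm{co}}\, T(S)$ in $\mathscr{L}(E)$ contains an element $P$ such that $RP = PR = P$ for every $R \in \overline{\mathrm{co}}\, T(S)$; - the fixed space $\operatorname{fix}(T) = \{x \in E : T_s x = x \text{ for every } s \in S\}$ is finite-dimensional. Then, for every unitary semigroup character $\chi$ of $S$ (a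 map $\chi \colon S \to \{z \in \mathbb{C} : |z| = 1\}$ with $\chi(0) = 1$ and $\chi(s+t) = \chi(s)\chi(t)$ for all $s,t \in S$), the eigenspace $\ker(\chi - T) = \{x \in E : T_s x = \chi(s) x \text{ for every } s \in S\}$ satisfies $$\dim_{\mathbb C} \ker(\chi - T) \le \dim_{\mathbb C} \operatorname{fix}(T).$$ -/

import Mathlib

/-!
Complex Banach lattices, uniformly mean ergodic semigroup representations and their eigenspaces.
-/

/-- The underlying set of the complexification `X ⊕ iX` of a real Banach lattice `X`:
the element with components `re`, `im` stands for `re + i im`. -/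
@[ext]
structure LatticeComplexification (X : Type*) where
  re : X
  im : X

namespace LatticeComplexification

section Algebra

variable {X : Type*} [AddCommGroup X]

instance : Zero (LatticeComplexification X) := ⟨⟨0, 0⟩⟩
instance : Add (LatticeComplexification X) := ⟨fun z w => ⟨z.re + w.re, z.im + w.im⟩⟩
instance : Neg (LatticeComplexification X) := ⟨fun z => ⟨-z.re, -z.im⟩⟩

@[simp] theorem re_zero : (0 : LatticeComplexification X).re = 0 := rfl
@[simp] theorem im_zero : (0 : LatticeComplexification X).im = 0 := rfl
@[simp] theorem re_add (z w : LatticeComplexification X) : (z + w).re = z.re + w.re := rfl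
@[simp] theorem im_add (z w : LatticeComplexification X) : (z + w).im = z.im + w.im := rfl
@[simp] theorem re_neg (z : LatticeComplexification X) : (-z).re = -z.re := rfl
@[simp] theorem im_neg (z : LatticeComplexification X) : (-z).im = -z.im := rfl

instance : AddCommGroup (LatticeComplexification X) where
  add_assoc z w v := by ext <;> simp [add_assoc]
  zero_add z := by ext <;> simp
  add_zero z := by ext <;> simp
  add_comm z w := by ext <;> simp [add_comm]
  neg_add_cancel z := by ext <;> simp
  nsmul := nsmulRec
  zsmul := zsmulRec

@[simp] theorem re_sub (z w : LatticeComplexification X) : (z - w).re = z.re - w.re := by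
  rw [sub_eq_add_neg, re_add, re_neg, sub_eq_add_neg]
@[simp] theorem im_sub (z w : LatticeComplexification X) : (z - w).im = z.im - w.im := by
  rw [sub_eq_add_neg, im_add, im_neg, sub_eq_add_neg]

variable [Module ℝ X]

/-- `(a + ib)(x + iy) = (ax - by) + i(ay + bx)`. -/
instance : SMul ℂ (LatticeComplexification X) :=
  ⟨fun a z => ⟨a.re • z.re - a.im • z.im, a.re • z.im + a.im • z.re⟩⟩

@[simp] theorem re_smul (a : ℂ) (z : LatticeComplexification X) :
    (a • z).re = a.re • z.re - a.im • z.im := rfl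
@[simp] theorem im_smul (a : ℂ) (z : LatticeComplexification X) :
    (a • z).im = a.re • z.im + a.im • z.re := rfl

instance : Module ℂ (LatticeComplexification X) where
  one_smul z := by ext <;> simp
  mul_smul a b z := by
    ext <;> simp only [re_smul, im_smul, Complex.mul_re, Complex.mul_im] <;> module
  smul_zero a := by ext <;> simp
  smul_add a z w := by ext <;> simp only [re_smul, im_smul, re_add, im_add] <;> module
  add_smul a b z := by
    ext <;> simp only [re_smul, im_smul, re_add, im_add, Complex.add_re, Complex.add_im] <;> module
  zero_smul z := by ext <;> simp

end Algebra

section Modulus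

variable {X : Type*} [NormedAddCommGroup X] [Lattice X] [IsOrderedAddMonoid X] [HasSolidNorm X]

theorem norm_le_norm_of_nonneg_le {a b : X} (ha : 0 ≤ a) (hab : a ≤ b) : ‖a‖ ≤ ‖b‖ :=
  norm_le_norm_of_abs_le_abs (by rwa [abs_of_nonneg ha, abs_of_nonneg (ha.trans hab)])

variable [NormedSpace ℝ X] [IsOrderedModule ℝ X]

theorem re_smul_sub_le (c d : ℂ) (z : LatticeComplexification X) :
    (c • z).re ≤ (d • z).re + ‖c - d‖ • (|z.re| + |z.im|) := by
  have habs : ∀ (r : ℝ) (x : X), r • x ≤ |r| • |x| := fun r x => by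
    rcases le_total 0 r with hr | hr
    · rw [abs_of_nonneg hr]
      exact smul_le_smul_of_nonneg_left (le_abs_self x) hr
    · rw [abs_of_nonpos hr, ← neg_smul_neg r x]
      exact smul_le_smul_of_nonneg_left (neg_le_abs x) (neg_nonneg.2 hr)
  have h1 : (c - d).re • z.re ≤ ‖c - d‖ • |z.re| :=
    (habs _ _).trans
      (smul_le_smul_of_nonneg_right (Complex.abs_re_le_norm _) (abs_nonneg _))
  have h2 : -((c - d).im • z.im) ≤ ‖c - d‖ • |z.im| := by
    rw [← neg_smul]
    refine (habs _ _).trans ?_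
    rw [abs_neg]
    exact smul_le_smul_of_nonneg_right (Complex.abs_im_le_norm _) (abs_nonneg _)
  have h3 : (c • z).re = (d • z).re + ((c - d).re • z.re + -((c - d).im • z.im)) := by
    simp only [re_smul, Complex.sub_re, Complex.sub_im]; module
  rw [h3, smul_add]
  gcongr

/-- Finite suprema approximate the modulus. -/
theorem exists_approx (z : LatticeComplexification X) {ε : ℝ} (hε : 0 < ε) :
    ∃ m : X, (∀ c : Circle, ((c : ℂ) • z).re ≤ m + ε • (|z.re| + |z.im|)) ∧
      ∀ b : X, (∀ c : Circle, ((c : ℂ) • z).re ≤ b) → m ≤ b := by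
  obtain ⟨t, -, htf, ht⟩ := Metric.totallyBounded_iff.1 (isCompact_univ (X := Circle)).totallyBounded ε hε |>.imp
    (fun t h => (⟨trivial, h.1, h.2⟩ : True ∧ t.Finite ∧ _))
  have hne : htf.toFinset.Nonempty := by
    obtain ⟨y, hy, -⟩ := Set.mem_iUnion₂.1 (ht (Set.mem_univ (1 : Circle)))
    exact ⟨y, by simpa using hy⟩
  refine ⟨htf.toFinset.sup' hne fun c => ((c : ℂ) • z).re, fun c => ?_, fun b hb => ?_⟩
  · obtain ⟨y, hy, hcy⟩ := Set.mem_iUnion₂.1 (ht (Set.mem_univ c))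
    refine (re_smul_sub_le (c : ℂ) (y : ℂ) z).trans ?_
    have hd : ‖(c : ℂ) - (y : ℂ)‖ ≤ ε := by
      have : dist (c : ℂ) (y : ℂ) < ε := hcy
      rw [dist_eq_norm] at this
      exact this.le
    exact add_le_add
      (Finset.le_sup' (fun c : Circle => ((c : ℂ) • z).re) (by simpa using hy))
      (smul_le_smul_of_nonneg_right hd (by positivity))
  · exact Finset.sup'_le _ _ fun c _ => hb c

variable [CompleteSpace X]

/-- In a Banach lattice the supremum defining the modulus exists. -/
theorem exists_isLUB (z : LatticeComplexification X) :
    ∃ m : X, IsLUB (Set.range fun c : Circle => ((c : ℂ) • z).re) m := by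
  set u : X := |z.re| + |z.im| with hu
  have hu0 : 0 ≤ u := by positivity
  choose m hm1 hm2 using fun n : ℕ => exists_approx z (ε := 1 / ((n : ℝ) + 1)) (by positivity)
  have hle : ∀ n k, m n ≤ m k + (1 / ((k : ℝ) + 1)) • u := fun n k => hm2 n _ (hm1 k)
  have hdist : ∀ N n k : ℕ, N ≤ n → N ≤ k → dist (m n) (m k) ≤ 1 / ((N : ℝ) + 1) * ‖u‖ := by
    intro N n k hn hk
    have key : ∀ i j : ℕ, N ≤ j → m i - m j ≤ (1 / ((N : ℝ) + 1)) • u := by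
      intro i j hj
      rw [sub_le_iff_le_add']
      refine (hle i j).trans ?_
      gcongr
    have habs : |m n - m k| ≤ |(1 / ((N : ℝ) + 1)) • u| := by
      rw [abs_of_nonneg (a := (1 / ((N : ℝ) + 1)) • u) (by positivity)]
      exact abs_le'.2 ⟨key n k hk, by rw [neg_sub]; exact key k n hn⟩
    rw [dist_eq_norm]
    refine (norm_le_norm_of_abs_le_abs habs).trans ?_
    rw [norm_smul, Real.norm_of_nonneg (by positivity)]
  have hlim0 : Filter.Tendsto (fun n : ℕ => 1 / ((n : ℝ) + 1)) Filter.atTop (nhds 0) :=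
    tendsto_one_div_add_atTop_nhds_zero_nat
  have hc : CauchySeq m :=
    cauchySeq_of_le_tendsto_0 (fun N : ℕ => 1 / ((N : ℝ) + 1) * ‖u‖)
      (fun n k N hn hk => hdist N n k hn hk) (by simpa using hlim0.mul_const ‖u‖)
  obtain ⟨l, hl⟩ := cauchySeq_tendsto_of_complete hc
  refine ⟨l, ?_, ?_⟩
  · rintro _ ⟨c, rfl⟩
    refine ge_of_tendsto' (x := Filter.atTop)
      (f := fun n : ℕ => m n + (1 / ((n : ℝ) + 1)) • u) ?_ fun n => hm1 n c
    simpa using hl.add (hlim0.smul_const u)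
  · intro b hb
    exact le_of_tendsto' hl fun n => hm2 n b fun c => hb ⟨c, rfl⟩

/-- The modulus `|z| = sup { Re (c z) : c ∈ ℂ, |c| = 1 }`, an element of the real lattice `X`. -/
noncomputable def modulus (z : LatticeComplexification X) : X := (exists_isLUB z).choose

theorem isLUB_modulus (z : LatticeComplexification X) :
    IsLUB (Set.range fun c : Circle => ((c : ℂ) • z).re) (modulus z) :=
  (exists_isLUB z).choose_spec

theorem le_modulus (c : Circle) (z : LatticeComplexification X) :
    ((c : ℂ) • z).re ≤ modulus z := (isLUB_modulus z).1 ⟨c, rfl⟩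

theorem modulus_le {z : LatticeComplexification X} {b : X}
    (h : ∀ c : Circle, ((c : ℂ) • z).re ≤ b) : modulus z ≤ b :=
  (isLUB_modulus z).2 (by rintro _ ⟨c, rfl⟩; exact h c)

theorem abs_re_le_modulus (z : LatticeComplexification X) : |z.re| ≤ modulus z :=
  abs_le'.2 ⟨by simpa using le_modulus 1 z,
    by simpa using le_modulus ⟨-1, by simp [Submonoid.unitSphere]⟩ z⟩

theorem abs_im_le_modulus (z : LatticeComplexification X) : |z.im| ≤ modulus z :=
  abs_le'.2 ⟨by simpa using le_modulus ⟨-Complex.I, by simp [Submonoid.unitSphere]⟩ z,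
    by simpa using le_modulus ⟨Complex.I, by simp [Submonoid.unitSphere]⟩ z⟩

theorem modulus_nonneg (z : LatticeComplexification X) : 0 ≤ modulus z :=
  (abs_nonneg _).trans (abs_re_le_modulus z)

theorem modulus_le_abs_add_abs (z : LatticeComplexification X) :
    modulus z ≤ |z.re| + |z.im| :=
  modulus_le fun c => by
    have h := re_smul_sub_le (c : ℂ) 0 z
    rwa [sub_zero, Circle.norm_coe, one_smul, zero_smul, re_zero, zero_add] at h

theorem modulus_add_le (z w : LatticeComplexification X) :
    modulus (z + w) ≤ modulus z + modulus w :=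
  modulus_le fun c => by
    rw [smul_add, re_add]; exact add_le_add (le_modulus c z) (le_modulus c w)

theorem modulus_smul_le (a : ℂ) (z : LatticeComplexification X) :
    modulus (a • z) ≤ ‖a‖ • modulus z :=
  modulus_le fun c => by
    rcases eq_or_ne a 0 with rfl | ha
    · simp
    · have hn : ‖a‖ ≠ 0 := norm_ne_zero_iff.2 ha
      have hd : (c : ℂ) * a = (‖a‖ : ℂ) * ((c : ℂ) * (a / (‖a‖ : ℂ))) := by
        have : (‖a‖ : ℂ) ≠ 0 := by exact_mod_cast hn
        field_simp
      have hmem : (c : ℂ) * (a / (‖a‖ : ℂ)) ∈ Submonoid.unitSphere ℂ := by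
        simp [Submonoid.unitSphere, hn, Circle.norm_coe]
      have h := le_modulus ⟨_, hmem⟩ z
      rw [smul_smul, hd, mul_smul, re_smul]
      simp only [Complex.ofReal_re, Complex.ofReal_im, zero_smul, sub_zero]
      exact smul_le_smul_of_nonneg_left h (norm_nonneg a)

theorem modulus_zero : modulus (0 : LatticeComplexification X) = 0 :=
  le_antisymm (modulus_le fun c => by simp) (modulus_nonneg _)

theorem modulus_neg (z : LatticeComplexification X) : modulus (-z) = modulus z := by
  have h : ∀ w : LatticeComplexification X, modulus (-w) ≤ modulus w := fun w => by
    simpa using modulus_smul_le (-1) w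
  exact le_antisymm (h z) (by simpa using h (-z))

/-- The norm of a complex Banach lattice: `‖z‖ = ‖ |z| ‖`. -/
noncomputable instance : NormedAddCommGroup (LatticeComplexification X) :=
  AddGroupNorm.toNormedAddCommGroup
    { toFun := fun z => ‖modulus z‖
      map_zero' := by rw [modulus_zero, norm_zero]
      add_le' := fun z w =>
        (norm_le_norm_of_nonneg_le (modulus_nonneg _) (modulus_add_le z w)).trans
          (norm_add_le _ _)
      neg' := fun z => by rw [modulus_neg]
      eq_zero_of_map_eq_zero' := fun z hz => by
        have h0 : modulus z = 0 := norm_eq_zero.1 hz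
        ext
        · exact norm_eq_zero.1 (le_antisymm
            ((norm_le_norm_of_abs_le_abs (by
              rw [abs_zero, ← h0]; exact abs_re_le_modulus z)).trans norm_zero.le) (norm_nonneg _))
        · exact norm_eq_zero.1 (le_antisymm
            ((norm_le_norm_of_abs_le_abs (by
              rw [abs_zero, ← h0]; exact abs_im_le_modulus z)).trans norm_zero.le)
                (norm_nonneg _)) }

theorem norm_def (z : LatticeComplexification X) : ‖z‖ = ‖modulus z‖ := rfl

noncomputable instance : NormedSpace ℂ (LatticeComplexification X) where
  norm_smul_le a z := by
    rw [norm_def, norm_def]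
    refine (norm_le_norm_of_nonneg_le (modulus_nonneg _) (modulus_smul_le a z)).trans ?_
    rw [norm_smul, norm_norm]

theorem norm_re_le (z : LatticeComplexification X) : ‖z.re‖ ≤ ‖z‖ :=
  norm_le_norm_of_abs_le_abs ((abs_re_le_modulus z).trans (le_abs_self _))

theorem norm_im_le (z : LatticeComplexification X) : ‖z.im‖ ≤ ‖z‖ :=
  norm_le_norm_of_abs_le_abs ((abs_im_le_modulus z).trans (le_abs_self _))

theorem norm_le_add (z : LatticeComplexification X) : ‖z‖ ≤ ‖z.re‖ + ‖z.im‖ := by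
  rw [norm_def, ← norm_abs_eq_norm z.re, ← norm_abs_eq_norm z.im]
  exact (norm_le_norm_of_nonneg_le (modulus_nonneg _) (modulus_le_abs_add_abs z)).trans
    (norm_add_le _ _)

theorem dist_re_le (z w : LatticeComplexification X) : dist z.re w.re ≤ dist z w := by
  rw [dist_eq_norm, dist_eq_norm, ← re_sub]
  exact norm_re_le (z - w)

theorem dist_im_le (z w : LatticeComplexification X) : dist z.im w.im ≤ dist z w := by
  rw [dist_eq_norm, dist_eq_norm, ← im_sub]
  exact norm_im_le (z - w)

theorem dist_le_add (z w : LatticeComplexification X) :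
    dist z w ≤ dist z.re w.re + dist z.im w.im := by
  rw [dist_eq_norm, dist_eq_norm, dist_eq_norm, ← re_sub, ← im_sub]
  exact norm_le_add (z - w)

instance : CompleteSpace (LatticeComplexification X) := by
  refine Metric.complete_of_cauchySeq_tendsto fun f hf => ?_
  have hre : CauchySeq fun n => (f n).re :=
    Metric.cauchySeq_iff.2 fun ε hε => (Metric.cauchySeq_iff.1 hf ε hε).imp
      fun N hN n hn k hk => (dist_re_le _ _).trans_lt (hN n hn k hk)
  have him : CauchySeq fun n => (f n).im :=
    Metric.cauchySeq_iff.2 fun ε hε => (Metric.cauchySeq_iff.1 hf ε hε).imp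
      fun N hN n hn k hk => (dist_im_le _ _).trans_lt (hN n hn k hk)
  obtain ⟨x, hx⟩ := cauchySeq_tendsto_of_complete hre
  obtain ⟨y, hy⟩ := cauchySeq_tendsto_of_complete him
  refine ⟨⟨x, y⟩, tendsto_iff_dist_tendsto_zero.2 ?_⟩
  have hxy := (tendsto_iff_dist_tendsto_zero.1 hx).add (tendsto_iff_dist_tendsto_zero.1 hy)
  rw [add_zero] at hxy
  exact squeeze_zero (fun _ => dist_nonneg) (fun n => dist_le_add (f n) ⟨x, y⟩) hxy

/-- A bounded operator on a complex Banach lattice is positive if it maps the positive cone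
`{x + i0 : x ≥ 0}` into itself. -/
def IsPositive (A : LatticeComplexification X →L[ℂ] LatticeComplexification X) : Prop :=
  ∀ x : X, 0 ≤ x → 0 ≤ (A ⟨x, 0⟩).re ∧ (A ⟨x, 0⟩).im = 0

end Modulus

end LatticeComplexification

/- A representation of the commutative semigroup `S` with neutral element `0` in `ℒ(E)` is an
`AddChar S (E →L[ℂ] E)`: `T 0 = 1` and `T (s + t) = T s * T t`.  A unitary semigroup character of
`S` is an `AddChar S Circle`. -/

namespace SemigroupRepresentation

variable {S E : Type*} [AddCommMonoid S] [NormedAddCommGroup E] [NormedSpace ℂ E]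

/-- `sup_s ‖T s‖ < ∞`. -/
def IsBounded (T : AddChar S (E →L[ℂ] E)) : Prop :=
  BddAbove (Set.range fun s : S => ‖T s‖)

/-- The operator norm closed convex hull of `T(S)` has a zero element `P`. -/
def IsUniformlyMeanErgodic (T : AddChar S (E →L[ℂ] E)) : Prop :=
  ∃ P ∈ closure (convexHull ℝ (Set.range fun s : S => T s)),
    ∀ R ∈ closure (convexHull ℝ (Set.range fun s : S => T s)), R * P = P ∧ P * R = P

/-- The eigenspace `ker (χ - T) = {x | T s x = χ s x for all s}`. -/
def eigenspace (T : AddChar S (E →L[ℂ] E)) (χ : AddChar S Circle) : Submodule ℂ E where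
  carrier := {x | ∀ s : S, T s x = (χ s : ℂ) • x}
  zero_mem' := by intro s; simp
  add_mem' := by
    intro x y hx hy s
    rw [map_add, hx s, hy s, smul_add]
  smul_mem' := by
    intro a x hx s
    rw [map_smul, hx s, smul_comm]

/-- The fixed space `fix T = {x | T s x = x for all s}`, the eigenspace for the constant
character `1`. -/
noncomputable def fixedSpace (T : AddChar S (E →L[ℂ] E)) : Submodule ℂ E := eigenspace T 1

end SemigroupRepresentation

/-! ### Disjoint families in finite-dimensional Archimedean vector lattices -/

namespace VectorLattice

variable {V : Type*} [AddCommGroup V] [Lattice V]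

/-! The mean ergodic projection `P` is positive, and its restriction `Q` to the real lattice is a
positive projection whose range embeds in the fixed space. With suprema `Q (v ⊔ w)` this range is a
finite-dimensional Archimedean vector lattice, so it has a basis `b i ≥ 0` with positive coordinates
(`exists_positive_basis_range`). Put `φ i = coordinate i ∘ Q` and `p i z = φ i |z|`.

If `z` is an eigenvector, then `|z| = |T s z| ≤ T s |z|`, and averaging gives `|z| ≤ Q |z| = ∑ p i z
• b i`. Hence the `p i` separate the points of the eigenspace. Moreover `|z| + |w|` is the supremum
of `|z + c w|` over unimodular `c`. Since `z + c w` is again an eigenvector, the same domination and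
`φ i (b j) = δ` yield `p i z + p i w ≤ sup_c p i (z + c w)`.

A seminorm with that property has a kernel of codimension at most one
(`exists_apply_sub_smul_eq_zero`): it is the modulus of a linear functional up to scale. Thus the
eigenspace embeds in a product of `n` spaces of dimension at most one, with `n = dim range Q ≤ dim
fix T`. -/

theorem inf_eq_zero_of_le {x y a : V} (hx : 0 ≤ x) (hxy : x ≤ y) (ha : 0 ≤ a)
    (hya : y ⊓ a = 0) : x ⊓ a = 0 :=
  le_antisymm ((inf_le_inf_right a hxy).trans hya.le) (le_inf hx ha)

/-- A finite set of nonzero positive pairwise disjoint elements. -/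
def IsDisjointFamily (s : Finset V) : Prop :=
  (∀ a ∈ s, 0 < a) ∧ ∀ a ∈ s, ∀ b ∈ s, a ≠ b → a ⊓ b = 0

theorem IsDisjointFamily.subset {s t : Finset V} (hs : IsDisjointFamily s) (h : t ⊆ s) :
    IsDisjointFamily t :=
  ⟨fun a ha => hs.1 a (h ha), fun a ha b hb => hs.2 a (h ha) b (h hb)⟩

theorem IsDisjointFamily.insert [DecidableEq V] {s : Finset V} (hs : IsDisjointFamily s) {x : V}
    (hx : 0 < x) (hxs : ∀ a ∈ s, x ⊓ a = 0) : IsDisjointFamily (insert x s) := by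
  refine ⟨fun a ha => ?_, fun a ha b hb hab => ?_⟩
  · rcases Finset.mem_insert.1 ha with rfl | ha
    exacts [hx, hs.1 a ha]
  · rcases Finset.mem_insert.1 ha with ha' | ha' <;> rcases Finset.mem_insert.1 hb with hb' | hb'
    · exact absurd (ha'.trans hb'.symm) hab
    · rw [ha']; exact hxs b hb'
    · rw [hb', inf_comm]; exact hxs a ha'
    · exact hs.2 a ha' b hb' hab

/-- Two disjoint parts of a member of a maximal disjoint family cannot both be nonzero. -/
theorem eq_zero_or_eq_zero_of_maximal {s : Finset V} (hs : IsDisjointFamily s)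
    (hmax : ∀ t : Finset V, IsDisjointFamily t → t.card ≤ s.card) {a p q : V} (ha : a ∈ s)
    (hp : 0 ≤ p) (hq : 0 ≤ q) (hpa : p ≤ a) (hqa : q ≤ a) (hpq : p ⊓ q = 0) : p = 0 ∨ q = 0 := by
  classical
  by_contra! hne
  have hp' := hp.lt_of_ne' hne.1
  have hq' := hq.lt_of_ne' hne.2
  have hdis : ∀ r : V, 0 ≤ r → r ≤ a → ∀ b ∈ s.erase a, r ⊓ b = 0 := fun r hr hra b hb => by
    have hb' := Finset.mem_erase.1 hb
    exact inf_eq_zero_of_le hr hra (hs.1 b hb'.2).le (hs.2 a ha b hb'.2 hb'.1.symm)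
  have hnot : ∀ r : V, 0 < r → r ≤ a → r ∉ s.erase a := fun r hr hra hmem => by
    have := hdis r hr.le hra r hmem
    rw [inf_idem] at this
    exact hr.ne' this
  -- Replacing `a` by both `p` and `q` would give a disjoint family with one more member.
  have h1 := (hs.subset (Finset.erase_subset a s)).insert hq' (hdis q hq hqa)
  have h2 := h1.insert hp' (by
    intro b hb
    rcases Finset.mem_insert.1 hb with rfl | hb
    exacts [hpq, hdis p hp hpa b hb])
  have h3 := hmax _ h2
  have hpq' : p ≠ q := by rintro rfl; rw [inf_idem] at hpq; exact hne.1 hpq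
  rw [Finset.card_insert_of_notMem (by
    rw [Finset.mem_insert, not_or]; exact ⟨hpq', hnot p hp' hpa⟩),
    Finset.card_insert_of_notMem (hnot q hq' hqa), Finset.card_erase_of_mem ha] at h3
  have := Finset.card_pos.2 ⟨a, ha⟩
  omega

variable [IsOrderedAddMonoid V]

theorem add_inf_eq_zero {x y a : V} (hx : 0 ≤ x) (hy : 0 ≤ y) (ha : 0 ≤ a)
    (hxa : x ⊓ a = 0) (hya : y ⊓ a = 0) : (x + y) ⊓ a = 0 := by
  refine le_antisymm ?_ (le_inf (add_nonneg hx hy) ha)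
  have h1 : (x + y) ⊓ a - y ≤ x ⊓ a :=
    le_inf (sub_le_iff_le_add.2 inf_le_left)
      ((sub_le_self _ hy).trans inf_le_right)
  rw [hxa, sub_nonpos] at h1
  rw [← hya]
  exact le_inf h1 inf_le_right

theorem sum_inf_eq_zero {ι : Type*} (s : Finset ι) (f : ι → V) {a : V} (ha : 0 ≤ a)
    (hf : ∀ i ∈ s, 0 ≤ f i) (hfa : ∀ i ∈ s, f i ⊓ a = 0) : (∑ i ∈ s, f i) ⊓ a = 0 := by
  classical
  induction s using Finset.induction_on with
  | empty => simpa using ha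
  | insert i s hi ih =>
    rw [Finset.sum_insert hi]
    exact add_inf_eq_zero (hf i (by simp)) (Finset.sum_nonneg fun j hj => hf j (by simp [hj])) ha
      (hfa i (by simp)) (ih (fun j hj => hf j (by simp [hj])) fun j hj => hfa j (by simp [hj]))

theorem add_inf_le {x y a : V} (hy : 0 ≤ y) : (x + y) ⊓ a ≤ x ⊓ a + y := by
  rw [← sub_le_iff_le_add]
  exact le_inf (sub_le_iff_le_add.2 inf_le_left) ((sub_le_self _ hy).trans inf_le_right)

variable [Module ℝ V] [IsOrderedModule ℝ V]

theorem smul_inf_eq_zero {x a : V} (hx : 0 ≤ x) (ha : 0 ≤ a) (h : x ⊓ a = 0) {t : ℝ}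
    (ht : 0 ≤ t) : (t • x) ⊓ a = 0 := by
  obtain ⟨n, hn⟩ := exists_nat_ge t
  have h1 : ((n : ℝ) • x) ⊓ a = 0 := by
    have := sum_inf_eq_zero (Finset.range n) (fun _ => x) ha (fun _ _ => hx) (fun _ _ => h)
    simpa [Nat.cast_smul_eq_nsmul] using this
  exact inf_eq_zero_of_le (smul_nonneg ht hx) (smul_le_smul_of_nonneg_right hn hx) ha h1

/-- If `c a < 0`, then `(-c a) • a` lies below a positive combination of the other members, all
disjoint from `a`. So `a` would be disjoint from itself, hence zero. -/
theorem IsDisjointFamily.nonneg_of_sum_nonneg {s : Finset V} (hs : IsDisjointFamily s) (c : V → ℝ)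
    (h : 0 ≤ ∑ b ∈ s, c b • b) {a : V} (ha : a ∈ s) : 0 ≤ c a := by
  classical
  by_contra! hc
  have ha0 := (hs.1 a ha).le
  set y := ∑ b ∈ s.erase a, |c b| • b with hy
  have hya : y ⊓ a = 0 := by
    refine sum_inf_eq_zero _ _ ha0
      (fun b hb => smul_nonneg (abs_nonneg _) (hs.1 b (Finset.mem_of_mem_erase hb)).le)
      fun b hb => ?_
    have hb' := Finset.mem_erase.1 hb
    exact smul_inf_eq_zero (hs.1 b hb'.2).le ha0 (hs.2 b hb'.2 a ha hb'.1) (abs_nonneg _)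
  have hle : (-c a) • a ≤ y := by
    rw [← Finset.add_sum_erase _ _ ha] at h
    rw [neg_smul, neg_le_iff_add_nonneg']
    exact h.trans (add_le_add_right (Finset.sum_le_sum fun b hb =>
      smul_le_smul_of_nonneg_right (le_abs_self _) (hs.1 b (Finset.mem_of_mem_erase hb)).le) _)
  have h0 : ((-c a) • a) ⊓ a = 0 :=
    inf_eq_zero_of_le (smul_nonneg (by linarith) ha0) hle ha0 hya
  have h1 : ((-c a)⁻¹ • (-c a) • a) ⊓ a = 0 :=
    smul_inf_eq_zero (smul_nonneg (by linarith) ha0) ha0 h0 (inv_nonneg.2 (by linarith))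
  rw [smul_smul, inv_mul_cancel₀ (by linarith), one_smul, inf_idem] at h1
  exact (hs.1 a ha).ne' h1

theorem IsDisjointFamily.linearIndependent {s : Finset V} (hs : IsDisjointFamily s) :
    LinearIndependent ℝ (fun a : s => (a : V)) := by
  rw [Fintype.linearIndependent_iff]
  classical
  intro g hg i
  set c : V → ℝ := fun a => if h : a ∈ s then g ⟨a, h⟩ else 0 with hc
  have hsum : ∑ b ∈ s, c b • b = 0 := by
    rw [← hg, ← Finset.sum_coe_sort]
    exact Finset.sum_congr rfl fun a _ => by simp [hc]
  have h1 := hs.nonneg_of_sum_nonneg c hsum.ge i.2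
  have h2 := hs.nonneg_of_sum_nonneg (fun a => -c a)
    (by simp only [neg_smul, Finset.sum_neg_distrib, hsum, neg_zero, le_refl]) i.2
  simp only [hc, i.2, dite_true] at h1 h2
  linarith

/-- Linear independence bounds the size of disjoint families by the dimension; maximality is in
cardinality. -/
theorem exists_maximal_disjointFamily [FiniteDimensional ℝ V] :
    ∃ s : Finset V, IsDisjointFamily s ∧ ∀ t : Finset V, IsDisjointFamily t → t.card ≤ s.card := by
  classical
  set Q : ℕ → Prop := fun n => ∃ s : Finset V, IsDisjointFamily s ∧ s.card = n
  have hQ0 : Q 0 := ⟨∅, ⟨by simp, by simp⟩, by simp⟩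
  have hbound : ∀ t : Finset V, IsDisjointFamily t → t.card ≤ Module.finrank ℝ V := fun t ht => by
    simpa using ht.linearIndependent.fintype_card_le_finrank
  obtain ⟨s, hs, hcard⟩ := Nat.findGreatest_spec (P := Q) (Nat.zero_le (Module.finrank ℝ V)) hQ0
  refine ⟨s, hs, fun t ht => ?_⟩
  rw [hcard]
  exact Nat.le_findGreatest (hbound t ht) ⟨t, ht, rfl⟩

/-- A positive vector agrees with a multiple of `a` on the band of `a`, for every member `a` of a
maximal disjoint family. -/
theorem exists_coordinate {s : Finset V} (hs : IsDisjointFamily s)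
    (hmax : ∀ t : Finset V, IsDisjointFamily t → t.card ≤ s.card)
    (harch : ∀ x y : V, (∀ ε : ℝ, 0 < ε → y ≤ ε • x) → y ≤ 0) {a : V} (ha : a ∈ s) {x : V}
    (hx : 0 ≤ x) : ∃ t : ℝ, |x - t • a| ⊓ a = 0 := by
  have ha0 := hs.1 a ha
  -- On the band of `a`, the vector `x` is comparable with every `t • a`. The coordinate is
  -- therefore a Dedekind cut, namely the supremum of the `t` with `t • a` below `x` there.
  have hsplit : ∀ t : ℝ, (x - t • a)⁺ ⊓ a = 0 ∨ (x - t • a)⁻ ⊓ a = 0 := fun t => by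
    refine eq_zero_or_eq_zero_of_maximal hs hmax ha (le_inf (posPart_nonneg _) ha0.le)
      (le_inf (negPart_nonneg _) ha0.le) inf_le_right inf_le_right ?_
    rw [inf_inf_inf_comm, inf_idem, posPart_inf_negPart_eq_zero]
    exact inf_eq_left.2 ha0.le
  set A : Set ℝ := {t | (x - t • a)⁻ ⊓ a = 0} with hA
  have h0A : (0 : ℝ) ∈ A := by
    simp only [hA, Set.mem_ofPred_eq, zero_smul, sub_zero, negPart_of_nonneg hx]
    exact inf_eq_left.2 ha0.le
  have hbdd : BddAbove A := by
    by_contra hb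
    rw [not_bddAbove_iff] at hb
    refine ha0.not_ge (harch x a fun ε hε => ?_)
    obtain ⟨t, htA, ht⟩ := hb ε⁻¹
    have ht0 : 0 < t := (inv_pos.2 hε).trans ht
    -- `(ta - x)⁺` is disjoint from `a` and below `ta`, hence zero
    have h1 : (x - t • a)⁻ ≤ t • a := by
      rw [negPart_def, neg_sub]
      exact sup_le (sub_le_self _ hx) (smul_nonneg ht0.le ha0.le)
    have h2 : (t⁻¹ • (x - t • a)⁻) ⊓ a = 0 :=
      smul_inf_eq_zero (negPart_nonneg _) ha0.le htA (inv_nonneg.2 ht0.le)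
    have h3 : t⁻¹ • (x - t • a)⁻ ≤ a := by
      have := smul_le_smul_of_nonneg_left h1 (inv_nonneg.2 ht0.le)
      rwa [smul_smul, inv_mul_cancel₀ ht0.ne', one_smul] at this
    rw [inf_eq_left.2 h3, smul_eq_zero_iff_right (inv_ne_zero ht0.ne'), negPart_eq_zero,
      sub_nonneg] at h2
    have h4 := smul_le_smul_of_nonneg_left h2 hε.le
    rw [smul_smul] at h4
    refine le_trans ?_ h4
    have h5 : (1 : ℝ) ≤ ε * t := by
      have := mul_lt_mul_of_pos_left ht hε
      rw [mul_inv_cancel₀ hε.ne'] at this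
      exact this.le
    simpa using smul_le_smul_of_nonneg_right h5 ha0.le
  refine ⟨sSup A, ?_⟩
  have hneg : (x - sSup A • a)⁻ ⊓ a = 0 := by
    refine le_antisymm (harch a _ fun ε hε => ?_) (le_inf (negPart_nonneg _) ha0.le)
    obtain ⟨t, htA, ht⟩ := exists_lt_of_lt_csSup ⟨0, h0A⟩ (sub_lt_self (sSup A) hε)
    have h1 : (x - sSup A • a)⁻ ≤ (x - t • a)⁻ + ε • a := by
      rw [negPart_def]
      refine sup_le ?_ (add_nonneg (negPart_nonneg _) (smul_nonneg hε.le ha0.le))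
      have h2 : -(x - sSup A • a) = -(x - t • a) + (sSup A - t) • a := by module
      rw [h2]
      exact add_le_add (neg_le_negPart _)
        (smul_le_smul_of_nonneg_right (by linarith) ha0.le)
    refine (inf_le_inf_right a h1).trans ((add_inf_le (smul_nonneg hε.le ha0.le)).trans ?_)
    rw [show (x - t • a)⁻ ⊓ a = 0 from htA, zero_add]
  -- Just above the supremum the negative part is not disjoint from `a`, so by the dichotomy the
  -- positive part is.
  have hposp : (x - sSup A • a)⁺ ⊓ a = 0 := by
    refine le_antisymm (harch a _ fun ε hε => ?_) (le_inf (posPart_nonneg _) ha0.le)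
    have htA : sSup A + ε ∉ A := fun h => by
      have := le_csSup hbdd h
      linarith
    have h1 : (x - sSup A • a)⁺ ≤ (x - (sSup A + ε) • a)⁺ + ε • a := by
      rw [posPart_def]
      refine sup_le ?_ (add_nonneg (posPart_nonneg _) (smul_nonneg hε.le ha0.le))
      have h2 : x - sSup A • a = (x - (sSup A + ε) • a) + ε • a := by module
      rw [h2]
      exact add_le_add_left (le_posPart _) _
    refine (inf_le_inf_right a h1).trans ((add_inf_le (smul_nonneg hε.le ha0.le)).trans ?_)
    rw [(hsplit _).resolve_right htA, zero_add]
  rw [← posPart_add_negPart]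
  exact add_inf_eq_zero (posPart_nonneg _) (negPart_nonneg _) ha0.le hposp hneg

theorem mem_span_of_maximal {s : Finset V} (hs : IsDisjointFamily s)
    (hmax : ∀ t : Finset V, IsDisjointFamily t → t.card ≤ s.card)
    (harch : ∀ x y : V, (∀ ε : ℝ, 0 < ε → y ≤ ε • x) → y ≤ 0) {x : V} (hx : 0 ≤ x) :
    x ∈ Submodule.span ℝ (s : Set V) := by
  classical
  choose! t ht using fun a (ha : a ∈ s) => exists_coordinate hs hmax harch ha hx
  set y := x - ∑ b ∈ s, t b • b with hy
  -- Only the term `t a • a` is felt on the band of `a`. A nonzero remainder could then be added to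
  -- the maximal family.
  have hdis : ∀ a ∈ s, |y| ⊓ a = 0 := fun a ha => by
    have ha0 := (hs.1 a ha).le
    have hrest : (∑ b ∈ s.erase a, |t b| • b) ⊓ a = 0 := by
      refine sum_inf_eq_zero _ _ ha0
        (fun b hb => smul_nonneg (abs_nonneg _) (hs.1 b (Finset.mem_of_mem_erase hb)).le)
        fun b hb => ?_
      have hb' := Finset.mem_erase.1 hb
      exact smul_inf_eq_zero (hs.1 b hb'.2).le ha0 (hs.2 b hb'.2 a ha hb'.1) (abs_nonneg _)
    have hrest0 : 0 ≤ ∑ b ∈ s.erase a, |t b| • b := Finset.sum_nonneg fun b hb =>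
      smul_nonneg (abs_nonneg _) (hs.1 b (Finset.mem_of_mem_erase hb)).le
    refine inf_eq_zero_of_le (abs_nonneg _) ?_ ha0
      (add_inf_eq_zero (abs_nonneg _) hrest0 ha0 (ht a ha) hrest)
    have hyeq : y = (x - t a • a) + ∑ b ∈ s.erase a, (-t b) • b := by
      rw [hy, ← Finset.add_sum_erase _ _ ha]
      simp only [neg_smul, Finset.sum_neg_distrib]
      abel
    rw [hyeq]
    refine (abs_add_le _ _).trans (add_le_add_right ?_ _)
    have hle : ∀ c : V → ℝ, (∀ b, c b ≤ |t b|) →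
        ∑ b ∈ s.erase a, c b • b ≤ ∑ b ∈ s.erase a, |t b| • b := fun c hc =>
      Finset.sum_le_sum fun b hb =>
        smul_le_smul_of_nonneg_right (hc b) (hs.1 b (Finset.mem_of_mem_erase hb)).le
    refine abs_le'.2 ⟨hle _ fun b => neg_le_abs _, ?_⟩
    rw [← Finset.sum_neg_distrib]
    simp only [neg_smul, neg_neg]
    exact hle _ fun b => le_abs_self _
  have hy0 : y = 0 := by
    by_contra hne
    have hpos : 0 < |y| := (abs_nonneg y).lt_of_ne' fun h => hne (by
      have h1 := le_abs_self y
      have h2 := neg_le_abs y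
      rw [h] at h1 h2
      exact le_antisymm h1 (neg_nonpos.1 h2))
    have hnot : |y| ∉ s := fun hmem => by
      have := hdis _ hmem
      rw [inf_idem] at this
      exact hpos.ne' this
    have := hmax _ (hs.insert hpos hdis)
    rw [Finset.card_insert_of_notMem hnot] at this
    omega
  rw [← sub_add_cancel x (∑ b ∈ s, t b • b), ← hy, hy0, zero_add]
  exact Submodule.sum_mem _ fun b hb =>
    Submodule.smul_mem _ _ (Submodule.subset_span (Finset.mem_coe.2 hb))

/-- A finite-dimensional Archimedean vector lattice is isomorphic to `ℝⁿ` with the coordinatewise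
order. -/
theorem exists_positive_basis [FiniteDimensional ℝ V]
    (harch : ∀ x y : V, (∀ ε : ℝ, 0 < ε → y ≤ ε • x) → y ≤ 0) :
    ∃ b : Module.Basis (Fin (Module.finrank ℝ V)) ℝ V,
      (∀ i, 0 ≤ b i) ∧ ∀ x, 0 ≤ x → ∀ i, 0 ≤ b.repr x i := by
  classical
  obtain ⟨s, hs, hmax⟩ := exists_maximal_disjointFamily (V := V)
  have hspan : ⊤ ≤ Submodule.span ℝ (Set.range fun a : s => (a : V)) := fun x _ => by
    have hr : Set.range (fun a : s => (a : V)) = (s : Set V) := by simp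
    rw [hr, ← posPart_sub_negPart x]
    exact Submodule.sub_mem _ (mem_span_of_maximal hs hmax harch (posPart_nonneg x))
      (mem_span_of_maximal hs hmax harch (negPart_nonneg x))
  let b := Module.Basis.mk hs.linearIndependent hspan
  have hb : ∀ i, b i = i := fun i => Module.Basis.mk_apply _ _ i
  have hcard : Fintype.card s = Module.finrank ℝ V := (Module.finrank_eq_card_basis b).symm
  refine ⟨b.reindex (Fintype.equivFinOfCardEq hcard), fun i => ?_, fun x hx i => ?_⟩
  · rw [Module.Basis.reindex_apply, hb]
    exact (hs.1 _ (Subtype.coe_prop _)).le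
  · rw [Module.Basis.repr_reindex_apply]
    set j := (Fintype.equivFinOfCardEq hcard).symm i
    let c : V → ℝ := fun a => if h : a ∈ s then b.repr x ⟨a, h⟩ else 0
    have hsum : ∑ a ∈ s, c a • a = x := by
      conv_rhs => rw [← b.sum_repr x]
      rw [← Finset.sum_coe_sort]
      exact Finset.sum_congr rfl fun a _ => by simp [c, hb]
    have := hs.nonneg_of_sum_nonneg c (hsum.symm ▸ hx) j.2
    simpa [c] using this

end VectorLattice

/-! ### Seminorms whose kernel has codimension at most one -/

theorem Complex.norm_one_add_add_norm_one_sub_le (u : ℂ) : ‖1 + u‖ + ‖1 - u‖ ≤ 2 + ‖u‖ ^ 2 := by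
  -- The squares add up to `2 + 2‖u‖²`, so the squared sum is at most `4 + 4‖u‖² ≤ (2 + ‖u‖²)²`.
  have h := parallelogram_law_with_norm ℝ (1 : ℂ) u
  rw [norm_one] at h
  nlinarith [sq_nonneg (‖1 + u‖ - ‖1 - u‖), sq_nonneg (‖u‖ ^ 2), norm_nonneg (1 + u),
    norm_nonneg (1 - u), sq_nonneg ‖u‖]

namespace Seminorm

variable {F : Type*} [AddCommGroup F] [Module ℂ F] (p : Seminorm ℂ F)

theorem continuous_circle_line (z w : F) : Continuous fun c : Circle => p (z + (c : ℂ) • w) := by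
  refine LipschitzWith.continuous (K := ⟨p w, apply_nonneg p w⟩) (LipschitzWith.of_dist_le_mul
    fun c d => ?_)
  rw [Real.dist_eq]
  refine (abs_sub_map_le_sub p _ _).trans ?_
  rw [add_sub_add_left_eq_sub, ← sub_smul, map_smul_eq_mul, mul_comm, ← dist_eq_norm]
  rfl

/-- If a seminorm satisfies `p z + p w ≤ sup { p (z + c w) : |c| = 1 }` for all `z`, `w`, then its
kernel has codimension at most one. -/
theorem exists_apply_sub_smul_eq_zero
    (hp : ∀ (z w : F) (M : ℝ), (∀ c : Circle, p (z + (c : ℂ) • w) ≤ M) → p z + p w ≤ M)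
    (z : F) {w : F} (hw : p w ≠ 0) : ∃ a : ℂ, p (z - a • w) = 0 := by
  -- the case of equality in the triangle inequality
  have key : ∀ (x y : F), p x = p y → p (x + y) = p x + p y → p (x - y) = 0 := by
    intro x y hxy hadd
    have hle : ∀ ε : ℝ, 0 < ε → p (x - y) ≤ ε * p x := by
      intro ε hε
      -- The left side gains `ε * p (x - y)`, of first order in `ε`, while the right side exceeds `2
      -- * p x` only to second order.
      have h := hp (x + y) ((ε : ℂ) • (x - y)) ((2 + ε ^ 2) * p x) fun c => by
        have h1 : x + y + (c : ℂ) • (ε : ℂ) • (x - y) =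
            (1 + (c : ℂ) * ε) • x + (1 - (c : ℂ) * ε) • y := by module
        have h2 := Complex.norm_one_add_add_norm_one_sub_le ((c : ℂ) * ε)
        have h3 : ‖(c : ℂ) * ε‖ = ε := by rw [norm_mul, Circle.norm_coe, one_mul, Complex.norm_real, Real.norm_of_nonneg hε.le]
        rw [h3] at h2
        rw [h1]
        refine (map_add_le_add p _ _).trans ?_
        rw [map_smul_eq_mul, map_smul_eq_mul, ← hxy, ← add_mul]
        exact mul_le_mul_of_nonneg_right h2 (apply_nonneg p x)
      rw [map_smul_eq_mul, hadd, ← hxy, Complex.norm_real, Real.norm_of_nonneg hε.le] at h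
      have : ε * p (x - y) ≤ ε * (ε * p x) := by linarith
      exact le_of_mul_le_mul_left this hε
    refine le_antisymm (le_of_forall_pos_le_add fun δ hδ => ?_) (apply_nonneg p _)
    have h0 := apply_nonneg p x
    -- The `+ 1` covers the case `p x = 0`.
    refine (hle (δ / (p x + 1)) (by positivity)).trans ?_
    rw [zero_add, div_mul_eq_mul_div, div_le_iff₀ (by positivity)]
    nlinarith
  have hw0 : 0 < p w := (apply_nonneg p w).lt_of_ne' hw
  set y : F := ((p z / p w : ℝ) : ℂ) • w with hy
  have hpy : p y = p z := by
    rw [hy, map_smul_eq_mul, Complex.norm_real,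
      Real.norm_of_nonneg (div_nonneg (apply_nonneg p z) hw0.le), div_mul_cancel₀ _ hw]
  -- At a maximising `c` the hypothesis forces equality in the triangle inequality for `z` and `c •
  -- y`, which have equal seminorm.
  obtain ⟨c, -, hc⟩ := (isCompact_univ (X := Circle)).exists_isMaxOn Set.univ_nonempty
    (p.continuous_circle_line z y).continuousOn
  have hcy : p ((c : ℂ) • y) = p y := by rw [map_smul_eq_mul, Circle.norm_coe, one_mul]
  have hmax := hp z y (p (z + (c : ℂ) • y)) fun d => hc (Set.mem_univ d)
  refine ⟨(c : ℂ) * ((p z / p w : ℝ) : ℂ), ?_⟩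
  rw [mul_smul, ← hy]
  refine key _ _ (by rw [hcy, hpy]) (le_antisymm (map_add_le_add p _ _) ?_)
  rwa [hcy]

/-- The kernel of a seminorm, as a submodule. -/
def kernel : Submodule ℂ F where
  carrier := {x | p x = 0}
  zero_mem' := map_zero p
  add_mem' {x y} hx hy := le_antisymm
    ((map_add_le_add p x y).trans (by rw [Set.mem_ofPred.1 hx, Set.mem_ofPred.1 hy, add_zero]))
    (apply_nonneg p _)
  smul_mem' a x hx := by
    rw [Set.mem_ofPred, map_smul_eq_mul, Set.mem_ofPred.1 hx, mul_zero]

theorem finite_quotient_kernel_and_finrank_le_one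
    (hp : ∀ (z w : F) (M : ℝ), (∀ c : Circle, p (z + (c : ℂ) • w) ≤ M) → p z + p w ≤ M) :
    Module.Finite ℂ (F ⧸ p.kernel) ∧ Module.finrank ℂ (F ⧸ p.kernel) ≤ 1 := by
  have h : ∃ v : F ⧸ p.kernel, ∀ x, ∃ a : ℂ, a • v = x := by
    by_cases hw : ∃ w, p w ≠ 0
    · obtain ⟨w, hw⟩ := hw
      refine ⟨p.kernel.mkQ w, fun x => ?_⟩
      obtain ⟨z, rfl⟩ := p.kernel.mkQ_surjective x
      obtain ⟨a, ha⟩ := p.exists_apply_sub_smul_eq_zero hp z hw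
      refine ⟨a, ?_⟩
      rw [← map_smul, eq_comm, ← sub_eq_zero, ← map_sub]
      exact (Submodule.Quotient.mk_eq_zero _).2 ha
    · push Not at hw
      refine ⟨0, fun x => ⟨0, ?_⟩⟩
      obtain ⟨z, rfl⟩ := p.kernel.mkQ_surjective x
      rw [smul_zero, eq_comm]
      exact (Submodule.Quotient.mk_eq_zero _).2 (hw z)
  obtain ⟨v, hv⟩ := h
  refine ⟨⟨{v}, ?_⟩, finrank_le_one v hv⟩
  rw [eq_top_iff]
  intro x _
  rw [Finset.coe_singleton]
  exact Submodule.mem_span_singleton.2 (hv x)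

/-- A space with a separating family of `n` seminorms whose kernels have codimension at most one
has dimension at most `n`. -/
theorem rank_le_of_separating {n : ℕ} (q : Fin n → Seminorm ℂ F)
    (hq : ∀ i (z w : F) (M : ℝ),
      (∀ c : Circle, q i (z + (c : ℂ) • w) ≤ M) → q i z + q i w ≤ M)
    (hsep : ∀ z, (∀ i, q i z = 0) → z = 0) : Module.rank ℂ F ≤ n := by
  have hfin := fun i => ((q i).finite_quotient_kernel_and_finrank_le_one (hq i)).1
  have hone := fun i => ((q i).finite_quotient_kernel_and_finrank_le_one (hq i)).2
  let f : F →ₗ[ℂ] (∀ i, F ⧸ (q i).kernel) := LinearMap.pi fun i => (q i).kernel.mkQ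
  have hf : Function.Injective f := by
    rw [injective_iff_map_eq_zero]
    intro z hz
    refine hsep z fun i => ?_
    exact (Submodule.Quotient.mk_eq_zero _).1 (congrFun hz i)
  have : Module.Finite ℂ F := Module.Finite.of_injective f hf
  rw [← Module.finrank_eq_rank, Nat.cast_le]
  refine (LinearMap.finrank_le_finrank_of_injective hf).trans ?_
  rw [Module.finrank_pi_fintype]
  exact (Finset.sum_le_sum fun i _ => hone i).trans (by simp)

end Seminorm

/-! ### Positive projections and positive operators on complex Banach lattices -/

namespace LatticeComplexification

/-- The Archimedean property: `ε • x` tends to zero and the order is norm closed. -/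
theorem nonpos_of_forall_le_smul {X : Type*} [NormedAddCommGroup X] [Lattice X]
    [IsOrderedAddMonoid X] [HasSolidNorm X] [NormedSpace ℝ X] {x y : X} (h : ∀ ε : ℝ, 0 < ε → y ≤ ε • x) : y ≤ 0 := by
  have hlim : Filter.Tendsto (fun n : ℕ => (1 / ((n : ℝ) + 1)) • x) Filter.atTop (nhds 0) := by
    rw [← zero_smul ℝ x]
    exact tendsto_one_div_add_atTop_nhds_zero_nat.smul_const x
  exact ge_of_tendsto' hlim fun n => h (1 / ((n : ℝ) + 1)) (by positivity)

variable {X : Type*} [NormedAddCommGroup X] [Lattice X] [IsOrderedAddMonoid X] [HasSolidNorm X]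
  [NormedSpace ℝ X] [IsOrderedModule ℝ X]

/-- The range of a positive projection on a vector lattice is a vector lattice for the inherited
order. -/
abbrev fixedLattice (Q : X →ₗ[ℝ] X) (hQ : ∀ x, 0 ≤ x → 0 ≤ Q x) (hQQ : ∀ x, Q (Q x) = Q x) :
    Lattice (LinearMap.range Q) :=
  have hmono : ∀ {x y : X}, x ≤ y → Q x ≤ Q y := fun {x y} h => by
    rw [← sub_nonneg, ← map_sub]; exact hQ _ (sub_nonneg.2 h)
  have hfix : ∀ v : LinearMap.range Q, Q v = v := by rintro ⟨_, x, rfl⟩; exact hQQ x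
  { (inferInstance : PartialOrder (LinearMap.range Q)) with
    -- The supremum in `X` may leave the range. Applying `Q` brings it back and, by monotonicity,
    -- keeps it below every upper bound fixed by `Q`.
    sup := fun v w => ⟨Q ((v : X) ⊔ (w : X)), _, rfl⟩
    inf := fun v w => ⟨Q ((v : X) ⊓ (w : X)), _, rfl⟩
    le_sup_left := fun v w => by
      have := hmono (le_sup_left : (v : X) ≤ (v : X) ⊔ w); rw [hfix] at this; exact this
    le_sup_right := fun v w => by
      have := hmono (le_sup_right : (w : X) ≤ (v : X) ⊔ w); rw [hfix] at this; exact this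
    sup_le := fun u v w h1 h2 => by
      have := hmono (sup_le (show (u : X) ≤ w from h1) (show (v : X) ≤ w from h2))
      rw [hfix] at this; exact this
    inf_le_left := fun v w => by
      have := hmono (inf_le_left : (v : X) ⊓ w ≤ v); rw [hfix] at this; exact this
    inf_le_right := fun v w => by
      have := hmono (inf_le_right : (v : X) ⊓ w ≤ w); rw [hfix] at this; exact this
    le_inf := fun u v w h1 h2 => by
      have := hmono (le_inf (show (u : X) ≤ v from h1) (show (u : X) ≤ w from h2))
      rw [hfix] at this; exact this }

theorem exists_positive_basis_range (Q : X →ₗ[ℝ] X) (hQ : ∀ x, 0 ≤ x → 0 ≤ Q x)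
    (hQQ : ∀ x, Q (Q x) = Q x) [FiniteDimensional ℝ (LinearMap.range Q)] :
    ∃ b : Module.Basis (Fin (Module.finrank ℝ (LinearMap.range Q))) ℝ (LinearMap.range Q),
      (∀ i, 0 ≤ (b i : X)) ∧ ∀ v : LinearMap.range Q, 0 ≤ (v : X) → ∀ i, 0 ≤ b.repr v i := by
  let := fixedLattice Q hQ hQQ
  have : IsOrderedAddMonoid (LinearMap.range Q) :=
    ⟨fun v w h u => add_le_add_left (show (v : X) ≤ w from h) (u : X),
      fun v w h u => add_le_add_right (show (v : X) ≤ w from h) (u : X)⟩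
  have : IsOrderedModule ℝ (LinearMap.range Q) :=
    { smul_le_smul_of_nonneg_left := fun r hr v w h => by
        have h1 : r • (v : X) ≤ r • (w : X) := smul_le_smul_of_nonneg_left h hr
        exact h1
      smul_le_smul_of_nonneg_right := fun v hv r t h => by
        have h1 : r • (v : X) ≤ t • (v : X) := smul_le_smul_of_nonneg_right h hv
        exact h1 }
  exact VectorLattice.exists_positive_basis fun x y h =>
    nonpos_of_forall_le_smul (x := (x : X)) (y := (y : X)) h

variable [CompleteSpace X]

theorem continuous_re : Continuous (re : LatticeComplexification X → X) :=
  (LipschitzWith.of_dist_le_mul (K := 1) fun z w => by simpa using dist_re_le z w).continuous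

theorem continuous_im : Continuous (im : LatticeComplexification X → X) :=
  (LipschitzWith.of_dist_le_mul (K := 1) fun z w => by simpa using dist_im_le z w).continuous

theorem re_real_smul (r : ℝ) (z : LatticeComplexification X) : (r • z).re = r • z.re := by
  rw [← Complex.coe_smul, re_smul]; simp

theorem im_real_smul (r : ℝ) (z : LatticeComplexification X) : (r • z).im = r • z.im := by
  rw [← Complex.coe_smul, im_smul]; simp

/-- The embedding `x ↦ x + i0`. -/
def ofReal : X →ₗ[ℝ] LatticeComplexification X where
  toFun x := ⟨x, 0⟩
  map_add' x y := by ext <;> simp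
  map_smul' r x := by ext <;> simp [re_real_smul, im_real_smul]

@[simp] theorem re_ofReal (x : X) : (ofReal x).re = x := rfl
@[simp] theorem im_ofReal (x : X) : (ofReal x).im = 0 := rfl

theorem eq_ofReal_add (z : LatticeComplexification X) :
    z = ofReal z.re + Complex.I • ofReal z.im := by
  ext <;> simp

/-- The compression `x ↦ Re (A x)` of an operator to the real lattice. -/
noncomputable def realPart (A : LatticeComplexification X →L[ℂ] LatticeComplexification X) :
    X →ₗ[ℝ] X where
  toFun x := (A (ofReal x)).re
  map_add' x y := by simp
  map_smul' r x := by
    rw [map_smul, ← Complex.coe_smul, map_smul, re_smul]; simp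

theorem realPart_apply (A : LatticeComplexification X →L[ℂ] LatticeComplexification X) (x : X) :
    realPart A x = (A (ofReal x)).re := rfl

theorem modulus_smul (a : ℂ) (z : LatticeComplexification X) :
    modulus (a • z) = ‖a‖ • modulus z := by
  refine le_antisymm (modulus_smul_le a z) ?_
  rcases eq_or_ne a 0 with rfl | ha
  · simp [modulus_nonneg]
  · have h := smul_le_smul_of_nonneg_left (modulus_smul_le a⁻¹ (a • z)) (norm_nonneg a)
    rwa [smul_smul, inv_mul_cancel₀ ha, one_smul, norm_inv, smul_smul,
      mul_inv_cancel₀ (norm_ne_zero_iff.2 ha), one_smul] at h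

theorem eq_zero_of_modulus_eq_zero {z : LatticeComplexification X} (h : modulus z = 0) : z = 0 :=
  norm_eq_zero.1 (by rw [norm_def, h, norm_zero])

/-- `|z| + |w|` is the supremum of the real parts of `c z + d w` over the torus. -/
theorem modulus_add_modulus_le {z w : LatticeComplexification X} {m : X}
    (h : ∀ c : Circle, modulus (z + (c : ℂ) • w) ≤ m) : modulus z + modulus w ≤ m := by
  rw [← le_sub_iff_add_le]
  refine modulus_le fun d => ?_
  rw [le_sub_comm]
  refine modulus_le fun e => ?_
  rw [le_sub_iff_add_le, add_comm, ← re_add]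
  -- Two independent phases reduce to one relative phase once `d` is factored out.
  refine le_trans ?_ (h (d⁻¹ * e))
  have h1 : (d : ℂ) • z + (e : ℂ) • w = (d : ℂ) • (z + ((d⁻¹ * e : Circle) : ℂ) • w) := by
    rw [smul_add, smul_smul, ← Circle.coe_mul, mul_inv_cancel_left]
  rw [h1]
  exact le_modulus d _

namespace IsPositive

variable {A : LatticeComplexification X →L[ℂ] LatticeComplexification X}

theorem realPart_nonneg (hA : IsPositive A) {x : X} (hx : 0 ≤ x) : 0 ≤ realPart A x :=
  (hA x hx).1

theorem realPart_mono (hA : IsPositive A) {x y : X} (h : x ≤ y) :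
    realPart A x ≤ realPart A y := by
  rw [← sub_nonneg, ← map_sub]
  exact hA.realPart_nonneg (sub_nonneg.2 h)

/-- Positivity speaks only of the cone, but every real vector is a difference of positive ones. -/
theorem apply_ofReal (hA : IsPositive A) (x : X) : A (ofReal x) = ofReal (realPart A x) := by
  ext
  · rfl
  · rw [← posPart_sub_negPart x, map_sub, map_sub, im_sub]
    have h1 : (A (ofReal x⁺)).im = 0 := (hA _ (posPart_nonneg x)).2
    have h2 : (A (ofReal x⁻)).im = 0 := (hA _ (negPart_nonneg x)).2
    rw [h1, h2, sub_zero, im_ofReal]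

theorem apply_re (hA : IsPositive A) (z : LatticeComplexification X) :
    (A z).re = realPart A z.re := by
  conv_lhs => rw [eq_ofReal_add z, map_add, map_smul, hA.apply_ofReal, hA.apply_ofReal]
  simp

/-- A positive operator commutes with real parts, so `Re (c A z) = A (Re (c z)) ≤ A |z|` for each
unimodular `c`. -/
theorem modulus_apply_le (hA : IsPositive A) (z : LatticeComplexification X) :
    modulus (A z) ≤ realPart A (modulus z) :=
  modulus_le fun c => by
    rw [← map_smul, hA.apply_re]
    exact hA.realPart_mono (le_modulus c z)

end IsPositive

theorem convex_setOf_isPositive :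
    Convex ℝ {A : LatticeComplexification X →L[ℂ] LatticeComplexification X | IsPositive A} := by
  intro A hA B hB a b ha hb _ x hx
  have h1 := hA x hx
  have h2 := hB x hx
  simp only [add_apply, smul_apply, re_add, im_add,
    re_real_smul, im_real_smul]
  rw [h1.2, h2.2]
  exact ⟨add_nonneg (smul_nonneg ha h1.1) (smul_nonneg hb h2.1), by simp⟩

theorem isClosed_setOf_isPositive :
    IsClosed {A : LatticeComplexification X →L[ℂ] LatticeComplexification X | IsPositive A} := by
  simp only [IsPositive, Set.ofPred_forall]
  refine isClosed_iInter fun x => isClosed_iInter fun _ => ?_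
  have hev : Continuous fun A : LatticeComplexification X →L[ℂ] LatticeComplexification X =>
      A ⟨x, 0⟩ := continuous_eval_const _
  exact (isClosed_le continuous_const (continuous_re.comp hev)).inter
    (isClosed_eq (continuous_im.comp hev) continuous_const)

/-- With closedness, this transports `|z| ≤ T s |z|` from the operators `T s` to `P`. -/
theorem convex_setOf_le_realPart (x : X) :
    Convex ℝ {A : LatticeComplexification X →L[ℂ] LatticeComplexification X |
      x ≤ realPart A x} := by
  intro A hA B hB a b ha hb hab
  have h : realPart (a • A + b • B) x = a • realPart A x + b • realPart B x := by
    simp [realPart_apply, re_real_smul]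
  rw [Set.mem_ofPred, h]
  calc x = a • x + b • x := by rw [← add_smul, hab, one_smul]
    _ ≤ _ := add_le_add (smul_le_smul_of_nonneg_left hA ha) (smul_le_smul_of_nonneg_left hB hb)

theorem isClosed_setOf_le_realPart (x : X) :
    IsClosed {A : LatticeComplexification X →L[ℂ] LatticeComplexification X |
      x ≤ realPart A x} :=
  isClosed_le continuous_const (continuous_re.comp (continuous_eval_const (ofReal x)))

end LatticeComplexification

/-! ### The mean ergodic projection and the dimension count -/

namespace SemigroupRepresentation

open LatticeComplexification

variable {S X : Type*} [AddCommMonoid S]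
    [NormedAddCommGroup X] [Lattice X] [IsOrderedAddMonoid X] [HasSolidNorm X]
    [NormedSpace ℝ X] [IsOrderedModule ℝ X] [CompleteSpace X]
    {T : AddChar S (LatticeComplexification X →L[ℂ] LatticeComplexification X)}
    {P : LatticeComplexification X →L[ℂ] LatticeComplexification X}

theorem isPositive_of_mem_closure (hpos : ∀ s : S, IsPositive (T s))
    (hP : P ∈ closure (convexHull ℝ (Set.range fun s : S => T s))) : IsPositive P :=
  closure_minimal (convexHull_min (by rintro _ ⟨s, rfl⟩; exact hpos s) convex_setOf_isPositive)
    isClosed_setOf_isPositive hP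

/-- The modulus of an eigenvector with unimodular eigenvalues is a subfixed point. -/
theorem modulus_le_realPart (hpos : ∀ s : S, IsPositive (T s))
    (hP : P ∈ closure (convexHull ℝ (Set.range fun s : S => T s))) {χ : AddChar S Circle}
    {z : LatticeComplexification X} (hz : z ∈ eigenspace T χ) :
    modulus z ≤ realPart P (modulus z) := by
  refine closure_minimal (convexHull_min ?_ (convex_setOf_le_realPart (modulus z)))
    (isClosed_setOf_le_realPart (modulus z)) hP
  rintro _ ⟨s, rfl⟩
  have h := (hpos s).modulus_apply_le z
  rwa [hz s, modulus_smul, Circle.norm_coe, one_smul] at h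

theorem ofReal_realPart_mem_fixedSpace (hpos : IsPositive P) (hTP : ∀ s, T s * P = P) (x : X) :
    ofReal (realPart P x) ∈ fixedSpace T := by
  intro s
  rw [← hpos.apply_ofReal, ← mul_apply_eq_comp, hTP]
  simp

theorem realPart_realPart (hpos : IsPositive P) (hPP : P * P = P) (x : X) :
    realPart P (realPart P x) = realPart P x := by
  rw [realPart_apply P (realPart P x), ← hpos.apply_ofReal, ← mul_apply_eq_comp, hPP,
    realPart_apply]

theorem finiteDimensional_range_realPart [FiniteDimensional ℂ (fixedSpace T)]
    (h : ∀ x, ofReal (realPart P x) ∈ fixedSpace T) :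
    FiniteDimensional ℝ (LinearMap.range (realPart P)) := by
  have : FiniteDimensional ℝ ((fixedSpace T).restrictScalars ℝ) :=
    FiniteDimensional.complexToReal (fixedSpace T)
  let j : LinearMap.range (realPart P) →ₗ[ℝ] (fixedSpace T).restrictScalars ℝ :=
    (ofReal.comp (LinearMap.range (realPart P)).subtype).codRestrict _ (by
      rintro ⟨_, x, rfl⟩; exact h x)
  refine FiniteDimensional.of_injective j fun v w hvw => Subtype.ext ?_
  exact congrArg LatticeComplexification.re (congrArg Subtype.val hvw)

/-- Real and imaginary parts of a complex relation between real vectors are real relations, so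
independence survives complexification. -/
theorem natCast_le_rank_fixedSpace {n : ℕ} {v : Fin n → X} (hv : LinearIndependent ℝ v)
    (h : ∀ i, ofReal (v i) ∈ fixedSpace T) : (n : Cardinal) ≤ Module.rank ℂ (fixedSpace T) := by
  have hli : LinearIndependent ℂ fun i => (⟨ofReal (v i), h i⟩ : fixedSpace T) := by
    rw [Fintype.linearIndependent_iff] at hv ⊢
    intro g hg i
    have hsum : ∑ j, g j • ofReal (v j) = 0 := by
      simpa using congrArg Subtype.val hg
    have hre : ∀ w : Fin n → LatticeComplexification X, (∑ j, w j).re = ∑ j, (w j).re :=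
      fun w => map_sum (AddMonoidHom.mk' LatticeComplexification.re re_add) w Finset.univ
    have him : ∀ w : Fin n → LatticeComplexification X, (∑ j, w j).im = ∑ j, (w j).im :=
      fun w => map_sum (AddMonoidHom.mk' LatticeComplexification.im im_add) w Finset.univ
    refine Complex.ext (hv (fun j => (g j).re) ?_ i) (hv (fun j => (g j).im) ?_ i)
    · simpa [hre] using congrArg LatticeComplexification.re hsum
    · simpa [him] using congrArg LatticeComplexification.im hsum
  simpa using hli.cardinal_lift_le_rank

/-- The seminorm `z ↦ φ(|z|)` induced by a positive functional `φ`. -/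
noncomputable def seminormOfPositive (φ : X →ₗ[ℝ] ℝ) (hφ : ∀ x, 0 ≤ x → 0 ≤ φ x) :
    Seminorm ℂ (LatticeComplexification X) :=
  Seminorm.of (fun z => φ (modulus z))
    (fun z w => by
      rw [← map_add, ← sub_nonneg, ← map_sub]
      exact hφ _ (sub_nonneg.2 (modulus_add_le z w)))
    fun a z => by rw [modulus_smul, map_smul, smul_eq_mul]

end SemigroupRepresentation

open LatticeComplexification SemigroupRepresentation in
theorem proposition3p13 {S X : Type*} [AddCommMonoid S]
    [NormedAddCommGroup X] [Lattice X] [IsOrderedAddMonoid X] [HasSolidNorm X]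
    [NormedSpace ℝ X] [IsOrderedModule ℝ X] [CompleteSpace X]
    (T : AddChar S (LatticeComplexification X →L[ℂ] LatticeComplexification X))
    (hbdd : SemigroupRepresentation.IsBounded T)
    (hpos : ∀ s : S, LatticeComplexification.IsPositive (T s))
    (hume : SemigroupRepresentation.IsUniformlyMeanErgodic T)
    (hfix : FiniteDimensional ℂ (SemigroupRepresentation.fixedSpace T))
    (χ : AddChar S Circle) :
    Module.rank ℂ (SemigroupRepresentation.eigenspace T χ) ≤
      Module.rank ℂ (SemigroupRepresentation.fixedSpace T) := by
  obtain ⟨P, hP, hPR⟩ := hume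
  have hPpos := isPositive_of_mem_closure hpos hP
  have hTP : ∀ s, T s * P = P := fun s =>
    (hPR _ (subset_closure (subset_convexHull ℝ _ ⟨s, rfl⟩))).1
  have hfixed := ofReal_realPart_mem_fixedSpace hPpos hTP
  have := finiteDimensional_range_realPart hfixed
  set Q := realPart P
  have hQQ : ∀ x, Q (Q x) = Q x := realPart_realPart hPpos (hPR P hP).1
  obtain ⟨b, hb, hcoord⟩ := exists_positive_basis_range Q (fun x => hPpos.realPart_nonneg) hQQ
  let φ : Fin (Module.finrank ℝ (LinearMap.range Q)) → X →ₗ[ℝ] ℝ :=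
    fun i => (b.coord i).comp Q.rangeRestrict
  have hφ : ∀ i x, 0 ≤ x → 0 ≤ φ i x := fun i x hx =>
    hcoord (Q.rangeRestrict x) (hPpos.realPart_nonneg hx) i
  have hφmono : ∀ i {x y}, x ≤ y → φ i x ≤ φ i y := fun i x y h => by
    rw [← sub_nonneg, ← map_sub]; exact hφ i _ (sub_nonneg.2 h)
  have hQsum : ∀ x, Q x = ∑ i, φ i x • (b i : X) := fun x => by
    have := congrArg Subtype.val (b.sum_repr (Q.rangeRestrict x))
    rw [Submodule.coe_sum] at this
    exact this.symm
  have hφb : ∀ i j, φ i (b j) = if j = i then 1 else 0 := fun i j => by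
    have h1 : Q.rangeRestrict (b j : X) = b j := Subtype.ext (by
      obtain ⟨x, hx⟩ := (b j).2
      change Q (b j : X) = b j
      rw [← hx, hQQ])
    change b.repr (Q.rangeRestrict (b j : X)) i = _
    rw [h1, b.repr_self, Finsupp.single_apply]
  have hsub : ∀ z ∈ eigenspace T χ, modulus z ≤ ∑ i, φ i (modulus z) • (b i : X) :=
    fun z hz => (modulus_le_realPart hpos hP hz).trans_eq (hQsum _)
  refine (Seminorm.rank_le_of_separating (n := Module.finrank ℝ (LinearMap.range Q))
    (fun i => (seminormOfPositive (φ i) (hφ i)).comp (eigenspace T χ).subtype) ?_ ?_).trans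
    (natCast_le_rank_fixedSpace
      (b.linearIndependent.map' (LinearMap.range Q).subtype (Submodule.ker_subtype _)) ?_)
  · rintro i ⟨z, hz⟩ ⟨w, hw⟩ M hM
    change ∀ c : Circle, φ i (modulus (z + (c : ℂ) • w)) ≤ M at hM
    change φ i (modulus z) + φ i (modulus w) ≤ M
    -- The bound `M` is needed only in coordinate `i`. Elsewhere the triangle inequality gives a
    -- bound independent of `c`, and `φ i` annihilates those terms afterwards.
    set m : Fin (Module.finrank ℝ (LinearMap.range Q)) → ℝ :=
      fun j => if j = i then M else φ j (modulus z) + φ j (modulus w) with hm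
    have hle : modulus z + modulus w ≤ ∑ j, m j • (b j : X) := by
      refine modulus_add_modulus_le fun c => ?_
      refine (hsub _ (Submodule.add_mem _ hz (Submodule.smul_mem _ _ hw))).trans
        (Finset.sum_le_sum fun j _ => smul_le_smul_of_nonneg_right ?_ (hb j))
      by_cases hj : j = i
      · subst hj; simpa [hm] using hM c
      · simp only [hm, hj, if_false]
        rw [← map_add]
        refine hφmono j ((modulus_add_le _ _).trans_eq ?_)
        rw [modulus_smul, Circle.norm_coe, one_smul]
    have := hφmono i hle
    simp only [map_add, map_sum, map_smul, hφb, smul_eq_mul, mul_ite, mul_one, mul_zero,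
      Finset.sum_ite_eq', Finset.mem_univ, if_true] at this
    simpa [hm] using this
  -- Separation: the dominating vector `∑ φ i |z| • b i` vanishes, hence so does `|z|`.
  · rintro ⟨z, hz⟩ hzero
    have hzero' : ∀ i, φ i (modulus z) = 0 := hzero
    have h := hsub z hz
    simp only [hzero', zero_smul, Finset.sum_const_zero] at h
    exact Subtype.ext (eq_zero_of_modulus_eq_zero (le_antisymm h (modulus_nonneg z)))
  · intro i
    obtain ⟨x, hx⟩ := (b i).2
    change ofReal (b i : X) ∈ _
    rw [← hx]
    exact hfixed x
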